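/- Conventions. An $m$-component virtual string link diagram (ordered, oriented) is presented by its Gauss diagram: for each component $i\in\{1,\dots,m\}$, the list of passages through classical crossings met along the component, each recorded as an overpass or an underpass at a named crossing with a sign $\pm1$; every crossing occurs exactly once as an overpass and once as an underpass. A welded string link is an equivalence class of such diagrams under renaming of crossings, the Reidemeister moves R1, R2, R3 and the overcrossings commute move OC (the virtual moves do not change the Gauss diagram). For $n\geq 1$, a $V^n$-move replaces two pieces of strand without classical crossings by two parallel pieces with $n$ classical crossings of the same sign, at all of which the same piece is the overpass. Two welded string links are related by $V^n$-moves if they are connected by a finite sequence of $V^n$-moves, their inverses and welded Reidemeister moves. For a diagram $D$ of a welded string link $\sigma$ let $a_{i1},\dots,a_{ir(i)}$ be the arcs of the $i$th component in order (the component is cut at its undercrossings), and let $u_{ij}=b^{\varepsilon}$, where $b$ is the arc passing over and $\varepsilon$ the sign at the crossing between $a_{ij}$ and $a_{i,j+1}$. Let $G(\sigma)$ be the group generated by the arcs with relators $a_{i,j+1}^{-1}u_{ij}^{-1}a_{ij}u_{ij}$, and let $l_i=a_{i1}^{s}u_{i1}\cdots u_{i,r(i)-1}$ be the $i$th preferred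 longitude, with $s\in\mathbb{Z}$ chosen so that the total exponent of the arcs $a_{i1},\dots,a_{ir(i)}$ in it is $0$. Let $G(\sigma)_q$ be the $q$th term of the lower central series, $G(\sigma)_1=G(\sigma)$. For a sequence $I=j_1\cdots j_k i$ in $\{1,\dots,m\}$ ($k\ge 0$, repeated entries allowed), choose $q>k$ and a word $\lambda_i$ in the free group on $\alpha_1,\dots,\alpha_m$ that becomes $l_i$ modulo $G(\sigma)_q$ when every $\alpha_j$ is replaced by $a_{j1}$. The welded Milnor invariant $\mu^{\mathrm w}_\sigma(I)\in\mathbb{Z}$ is the coefficient of $X_{j_1}\cdots X_{j_k}$ in $E(\lambda_i)$, where $E$ is the Magnus expansion, the homomorphism into the units of $\mathbb{Z}\langle\langle X_1,\dots,X_m\rangle\rangle$ with $E(\alpha_j)=1+X_j$. Proposition. Let $p$ be a prime number, and let $\sigma,\sigma'$ be two $m$-component welded string links that are related by $V^{p}$-moves. Let $I$ be any non-empty sequence of elements of $\{1,\dots,m\}$ of length at most $p$, possibly with repeated entries. Then the integers $\mu^{\mathrm w}_{\sigma}(I)$ and $\mu^{\mathrm w}_{\sigma'}(I)$ are well defined (such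 words exist, and the value depends neither on the diagram, nor on $q$, nor on the word), and $$\mu^{\mathrm w}_{\sigma}(I)\equiv\mu^{\mathrm w}_{\sigma'}(I)\pmod{p}.$$ -/

import Mathlib

noncomputable section

/-! ## Gauss diagrams of virtual string links

A virtual string link diagram, considered up to planar isotopy and the virtual moves, is recorded
by the signed over/under words read along its components, that is, by its Gauss diagram. -/

namespace WeldedSL

/-- A passage of a strand through a classical crossing: the name of the crossing, whether the
strand is the overpass (`true`, an arrow tail) or the underpass (`false`, an arrow head), and the
sign of the crossing. -/
structure Passage where
  label : ℕ
  isOver : Bool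
  sign : ℤˣ

/-- The overpass at the crossing `c` of sign `ε`. -/
def O (c : ℕ) (ε : ℤˣ) : Passage := ⟨c, true, ε⟩

/-- The underpass at the crossing `c` of sign `ε`. -/
def U (c : ℕ) (ε : ℤˣ) : Passage := ⟨c, false, ε⟩

/-- An `m`-component virtual string link diagram, presented by its Gauss diagram: `strand i` is the
list of passages met along the `i`th component, in the order given by the orientation. Each crossing
is met exactly twice, once as an overpass and once as an underpass, with the same sign. -/
structure Diagram (m : ℕ) where
  strand : Fin m → List Passage
  nodup : (((List.finRange m).flatMap strand).map fun e => (e.label, e.isOver)).Nodup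
  paired : ∀ i, ∀ e ∈ strand i, ∃ k, (⟨e.label, !e.isOver, e.sign⟩ : Passage) ∈ strand k

/-- Fill the numbered holes of a family of words with the words `x`. -/
def fill {m k : ℕ} (C : Fin m → List (Passage ⊕ Fin k)) (x : Fin k → List Passage) :
    Fin m → List Passage :=
  fun i => (C i).flatMap (Sum.elim (fun e => [e]) x)

/-- `D` and `D'` coincide outside a disk, which they meet in `k` strands; along the `h`th of these
strands `D` reads `x h` inside the disk and `D'` reads `y h`. The outside part is `C`, in which every
hole `h : Fin k` occurs exactly once. (The holes may lie on any components and in any order, since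
a Gauss diagram does not record virtual crossings.) -/
def LocalMove {m k : ℕ} (x y : Fin k → List Passage) (D D' : Diagram m) : Prop :=
  ∃ C : Fin m → List (Passage ⊕ Fin k),
    ((List.finRange m).flatMap fun i => (C i).filterMap Sum.getRight?).Perm (List.finRange k) ∧
    D.strand = fill C x ∧ D'.strand = fill C y

/-- Read a word forwards (`1`) or backwards (`-1`). -/
def orient (ε : ℤˣ) (w : List Passage) : List Passage := if ε = 1 then w else w.reverse

/-- The welded Reidemeister moves on Gauss diagrams. The virtual moves V1, V2, V3, V4 do not change the
Gauss diagram, so that R1, R2, R3 and OC remain. In `r3`, the strands are the top, the middle and the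
bottom one, with orientations `t`, `n`, `b`; `a` is the crossing of top over middle, `d` of top over
bottom, `c` of middle over bottom; `η` distinguishes a configuration from its mirror image. -/
inductive WeldedMove {m : ℕ} : Diagram m → Diagram m → Prop
  /-- Renaming the crossings. -/
  | rename (f : Equiv.Perm ℕ) {D D' : Diagram m}
      (h : ∀ i, D'.strand i = (D.strand i).map fun e => ⟨f e.label, e.isOver, e.sign⟩) :
      WeldedMove D D'
  | r1_over_under (c : ℕ) (ε : ℤˣ) {D D' : Diagram m}
      (h : LocalMove ![[]] ![[O c ε, U c ε]] D D') : WeldedMove D D'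
  | r1_under_over (c : ℕ) (ε : ℤˣ) {D D' : Diagram m}
      (h : LocalMove ![[]] ![[U c ε, O c ε]] D D') : WeldedMove D D'
  /-- R2 between parallel strands. -/
  | r2_parallel (c d : ℕ) (ε : ℤˣ) {D D' : Diagram m}
      (h : LocalMove ![[], []] ![[O c ε, O d (-ε)], [U c ε, U d (-ε)]] D D') : WeldedMove D D'
  /-- R2 between antiparallel strands. -/
  | r2_antiparallel (c d : ℕ) (ε : ℤˣ) {D D' : Diagram m}
      (h : LocalMove ![[], []] ![[O c ε, O d (-ε)], [U d (-ε), U c ε]] D D') : WeldedMove D D'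
  | r3 (a d c : ℕ) (η t n b : ℤˣ) {D D' : Diagram m}
      (h : LocalMove
        ![orient t [O a (η * t * n), O d (η * t * b)],
          orient n [U a (η * t * n), O c (η * n * b)],
          orient b [U d (η * t * b), U c (η * n * b)]]
        ![orient t [O d (η * t * b), O a (η * t * n)],
          orient n [O c (η * n * b), U a (η * t * n)],
          orient b [U c (η * n * b), U d (η * t * b)]] D D') : WeldedMove D D'
  /-- Overcrossings commute. -/
  | oc (c d : ℕ) (ε δ : ℤˣ) {D D' : Diagram m}
      (h : LocalMove ![[O c ε, O d δ]] ![[O d δ, O c ε]] D D') : WeldedMove D D'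

/-- `m`-component welded string links: diagrams up to welded isotopy (the equivalence relation
generated by the welded Reidemeister moves). -/
def WeldedStringLink (m : ℕ) : Type := Quot (WeldedMove (m := m))

/-- The `V^n`-move on diagrams: two strands without classical crossing in the disk are replaced by two
parallel strands with `n` classical crossings of the same sign, at all of which the same strand is
the overpass (in the plane these alternate with `n` virtual crossings). -/
def VMove (n : ℕ) {m : ℕ} (D D' : Diagram m) : Prop :=
  ∃ (c : Fin n → ℕ) (ε : ℤˣ),
    LocalMove ![[], []] ![List.ofFn fun j => O (c j) ε, List.ofFn fun j => U (c j) ε] D D'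

/-- Two welded string links are related by `V^n`-moves: they are related by a finite sequence of
`V^n`-moves, of their inverses and of welded isotopies. -/
def VRelated (n : ℕ) {m : ℕ} : WeldedStringLink m → WeldedStringLink m → Prop :=
  Relation.EqvGen fun σ σ' => ∃ D D' : Diagram m,
    σ = Quot.mk WeldedMove D ∧ σ' = Quot.mk WeldedMove D' ∧ VMove n D D'

/-! ## The group of a welded string link and its longitudes -/

namespace Diagram

variable {m : ℕ} (D : Diagram m)

/-- The underpasses along the `i`th component. -/
def unders (i : Fin m) : List Passage := (D.strand i).filter fun e => !e.isOver

/-- The arcs of `D`: the underpasses cut the `i`th component into `r(i)` arcs, one more than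
their number. The arc `⟨i, 0⟩` is the initial arc, that is, the `i`th meridian. -/
abbrev Arc : Type := (i : Fin m) × Fin ((D.unders i).length + 1)

/-- The overpass of the crossing `c` lies on the arc `a`: it is on the component of `a`, and the
number of underpasses before it is the index of `a`. -/
def IsOverArc (c : ℕ) (a : D.Arc) : Prop :=
  ∃ (l₁ l₂ : List Passage) (e : Passage), D.strand a.1 = l₁ ++ e :: l₂ ∧
    e.label = c ∧ e.isOver = true ∧ (a.2 : ℕ) = (l₁.filter fun e => !e.isOver).length

theorem exists_isOverArc (i : Fin m) (j : Fin (D.unders i).length) :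
    ∃ a, D.IsOverArc ((D.unders i).get j).label a := by
  have h := List.get_mem (D.unders i) j
  obtain ⟨h1, h2⟩ := List.mem_filter.1 h
  obtain ⟨k, hk⟩ := D.paired i _ h1
  obtain ⟨l₁, l₂, hl⟩ := List.append_of_mem hk
  have hlen : (l₁.filter fun e => !e.isOver).length < (D.unders k).length + 1 := by
    simp only [unders, hl, List.filter_append, List.length_append]
    omega
  refine ⟨⟨k, ⟨_, hlen⟩⟩, l₁, l₂, _, hl, rfl, ?_, rfl⟩
  simpa using h2

/-- The arc containing the overpass at the `j`th undercrossing of the `i`th component. -/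
def overArc (i : Fin m) (j : Fin (D.unders i).length) : D.Arc :=
  Classical.choose (D.exists_isOverArc i j)

/-- The sign of the `j`th undercrossing of the `i`th component. -/
def underSign (i : Fin m) (j : Fin (D.unders i).length) : ℤ := ((D.unders i).get j).sign

/-- The element `u_{ij}`: the generator of the overpassing arc, to the power the sign. -/
def u (i : Fin m) (j : Fin (D.unders i).length) : FreeGroup D.Arc :=
  FreeGroup.of (D.overArc i j) ^ D.underSign i j

/-- The Wirtinger relators `a_{i,j+1}⁻¹ u_{ij}⁻¹ a_{ij} u_{ij}`. -/
def relators : Set (FreeGroup D.Arc) :=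
  {r | ∃ (i : Fin m) (j : Fin (D.unders i).length),
    r = (FreeGroup.of ⟨i, j.succ⟩)⁻¹ * (D.u i j)⁻¹ * FreeGroup.of ⟨i, j.castSucc⟩ * D.u i j}

/-- The group `G(D)`. -/
abbrev WirtingerGroup : Type := PresentedGroup D.relators

/-- The `i`th meridian. -/
def meridian (i : Fin m) : D.WirtingerGroup := PresentedGroup.of ⟨i, 0⟩

/-- The exponent `s` that makes the exponent sum of the generators of the `i`th component in
`a_{i1} ^ s u_{i1} u_{i2} ⋯` equal to zero. -/
def framing (i : Fin m) : ℤ := -∑ j, if (D.overArc i j).1 = i then D.underSign i j else 0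

/-- The `i`th preferred longitude `a_{i1} ^ s u_{i1} u_{i2} ⋯`, an element of `G(D)`. -/
def longitude (i : Fin m) : D.WirtingerGroup :=
  D.meridian i ^ D.framing i * PresentedGroup.mk D.relators (List.ofFn (D.u i)).prod

/-- The word `w` in `α_1, …, α_m` expresses the `i`th preferred longitude modulo the `q`th term of the
lower central series of `G(D)`. (The first term is the group itself.) -/
def IsLongitudeWord (q : ℕ) (i : Fin m) (w : FreeGroup (Fin m)) : Prop :=
  (FreeGroup.lift D.meridian w)⁻¹ * D.longitude i ∈
    Subgroup.lowerCentralSeries (⊤ : Subgroup D.WirtingerGroup) (q - 1)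

end Diagram

/-! ## Formal power series in noncommuting variables and the Magnus expansion -/

/-- Formal power series in noncommuting variables `X_1, …, X_m` with integer coefficients: the
value at a list `[j₁, …, j_k]` is the coefficient of `X_{j₁} ⋯ X_{j_k}`. -/
@[ext]
structure NCSeries (m : ℕ) where
  coeff : List (Fin m) → ℤ

namespace NCSeries

variable {m : ℕ}

instance : Zero (NCSeries m) := ⟨⟨fun _ => 0⟩⟩
instance : One (NCSeries m) := ⟨⟨fun w => if w = [] then 1 else 0⟩⟩
instance : Add (NCSeries m) := ⟨fun f g => ⟨fun w => f.coeff w + g.coeff w⟩⟩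
instance : Neg (NCSeries m) := ⟨fun f => ⟨fun w => -f.coeff w⟩⟩

/-- The Cauchy product: sum over all ways to cut the word `w` in two. -/
instance : Mul (NCSeries m) :=
  ⟨fun f g => ⟨fun w => ∑ k ∈ Finset.range (w.length + 1),
    f.coeff (w.take k) * g.coeff (w.drop k)⟩⟩

/-- The variable `X_i`. -/
def X (i : Fin m) : NCSeries m := ⟨fun w => if w = [i] then 1 else 0⟩

/-- The series `1 - X_i + X_i ^ 2 - X_i ^ 3 + ⋯`. -/
def geom (i : Fin m) : NCSeries m :=
  ⟨fun w => if w = List.replicate w.length i then (-1) ^ w.length else 0⟩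

/-- Auxiliary: the coefficients of the words that begin with `a`. -/
def tail (a : Fin m) (f : NCSeries m) : NCSeries m := ⟨fun w => f.coeff (a :: w)⟩

theorem coeff_zero (w : List (Fin m)) : (0 : NCSeries m).coeff w = 0 := rfl
theorem coeff_one (w : List (Fin m)) : (1 : NCSeries m).coeff w = if w = [] then 1 else 0 := rfl
theorem coeff_add (f g : NCSeries m) (w : List (Fin m)) :
    (f + g).coeff w = f.coeff w + g.coeff w := rfl
theorem coeff_neg (f : NCSeries m) (w : List (Fin m)) : (-f).coeff w = -f.coeff w := rfl
theorem coeff_tail (a : Fin m) (f : NCSeries m) (w : List (Fin m)) :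
    (tail a f).coeff w = f.coeff (a :: w) := rfl
theorem coeff_X (i : Fin m) (w : List (Fin m)) :
    (X i).coeff w = if w = [i] then 1 else 0 := rfl
theorem coeff_geom (i : Fin m) (w : List (Fin m)) :
    (geom i).coeff w = if w = List.replicate w.length i then (-1) ^ w.length else 0 := rfl

theorem coeff_mul_nil (f g : NCSeries m) : (f * g).coeff [] = f.coeff [] * g.coeff [] := by
  change ∑ k ∈ Finset.range 1, _ = _
  simp

theorem coeff_mul_cons (f g : NCSeries m) (a : Fin m) (w : List (Fin m)) :
    (f * g).coeff (a :: w) = f.coeff [] * g.coeff (a :: w) + (tail a f * g).coeff w := by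
  change ∑ k ∈ Finset.range (w.length + 1 + 1), _ = _ + ∑ k ∈ Finset.range (w.length + 1), _
  rw [Finset.sum_range_succ', add_comm]
  rfl

theorem coeff_mul_add (f g h : NCSeries m) (w : List (Fin m)) :
    (f * (g + h)).coeff w = (f * g).coeff w + (f * h).coeff w := by
  induction w generalizing f with
  | nil => simp only [coeff_mul_nil, coeff_add]; ring
  | cons a w ih => simp only [coeff_mul_cons, coeff_add, ih]; ring

theorem coeff_add_mul (f g h : NCSeries m) (w : List (Fin m)) :
    ((f + g) * h).coeff w = (f * h).coeff w + (g * h).coeff w := by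
  induction w generalizing f g with
  | nil => simp only [coeff_mul_nil, coeff_add]; ring
  | cons a w ih =>
    have e : tail a (f + g) = tail a f + tail a g := rfl
    simp only [coeff_mul_cons, coeff_add, e, ih]; ring

theorem coeff_zero_mul (f : NCSeries m) (w : List (Fin m)) : (0 * f).coeff w = 0 := by
  induction w with
  | nil => simp [coeff_mul_nil, coeff_zero]
  | cons a w ih =>
    have e : tail a (0 : NCSeries m) = 0 := rfl
    simp [coeff_mul_cons, e, ih, coeff_zero]

theorem coeff_mul_zero (f : NCSeries m) (w : List (Fin m)) : (f * 0).coeff w = 0 := by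
  induction w generalizing f with
  | nil => simp [coeff_mul_nil, coeff_zero]
  | cons a w ih => simp [coeff_mul_cons, ih, coeff_zero]

theorem coeff_one_mul (f : NCSeries m) (w : List (Fin m)) : (1 * f).coeff w = f.coeff w := by
  cases w with
  | nil => simp [coeff_mul_nil, coeff_one]
  | cons a w =>
    have e : tail a (1 : NCSeries m) = 0 := by ext w; simp [coeff_tail, coeff_one, coeff_zero]
    simp [coeff_mul_cons, e, coeff_zero_mul, coeff_one]

theorem coeff_mul_one (f : NCSeries m) (w : List (Fin m)) : (f * 1).coeff w = f.coeff w := by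
  induction w generalizing f with
  | nil => simp [coeff_mul_nil, coeff_one]
  | cons a w ih => simp [coeff_mul_cons, ih, coeff_one, coeff_tail]

theorem coeff_mul_assoc (f g h : NCSeries m) (w : List (Fin m)) :
    (f * g * h).coeff w = (f * (g * h)).coeff w := by
  induction w generalizing f g with
  | nil => simp only [coeff_mul_nil]; ring
  | cons a w ih =>
    have e : tail a (f * g) = ⟨fun _ => 0⟩ + (⟨fun v => f.coeff [] * g.coeff (a :: v)⟩ +
        tail a f * g) := by
      ext v
      simp [coeff_tail, coeff_mul_cons, coeff_add]
    have s : ∀ (c : ℤ) (p : NCSeries m) (v : List (Fin m)),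
        ((⟨fun v => c * p.coeff v⟩ : NCSeries m) * h).coeff v = c * (p * h).coeff v := by
      intro c p v
      change ∑ k ∈ Finset.range (v.length + 1), c * p.coeff (v.take k) * h.coeff (v.drop k) =
        c * ∑ k ∈ Finset.range (v.length + 1), p.coeff (v.take k) * h.coeff (v.drop k)
      rw [Finset.mul_sum]
      exact Finset.sum_congr rfl fun k _ => mul_assoc _ _ _
    have z : (⟨fun _ => 0⟩ : NCSeries m) = 0 := rfl
    have s' := s (f.coeff []) (tail a g) w
    simp only [coeff_tail] at s'
    rw [coeff_mul_cons, e, coeff_add_mul, coeff_add_mul, z, coeff_zero_mul, s', ih,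
      coeff_mul_nil, coeff_mul_cons f, coeff_mul_cons g]
    ring

instance : Ring (NCSeries m) where
  add_assoc f g h := by ext w; simp only [coeff_add]; ring
  zero_add f := by ext w; simp only [coeff_add, coeff_zero]; ring
  add_zero f := by ext w; simp only [coeff_add, coeff_zero]; ring
  add_comm f g := by ext w; simp only [coeff_add]; ring
  neg_add_cancel f := by ext w; simp only [coeff_add, coeff_neg, coeff_zero]; ring
  nsmul := nsmulRec
  zsmul := zsmulRec
  left_distrib f g h := by ext w; exact coeff_mul_add f g h w
  right_distrib f g h := by ext w; exact coeff_add_mul f g h w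
  zero_mul f := by ext w; exact coeff_zero_mul f w
  mul_zero f := by ext w; exact coeff_mul_zero f w
  mul_assoc f g h := by ext w; exact coeff_mul_assoc f g h w
  one_mul f := by ext w; exact coeff_one_mul f w
  mul_one f := by ext w; exact coeff_mul_one f w

theorem coeff_one_add_X_mul_cons (i a : Fin m) (f : NCSeries m) (w : List (Fin m)) :
    ((1 + X i) * f).coeff (a :: w) = f.coeff (a :: w) + if a = i then f.coeff w else 0 := by
  rw [add_mul, one_mul, coeff_add, coeff_mul_cons]
  have e : tail a (X i) = if a = i then 1 else 0 := by
    ext w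
    split_ifs with h <;> simp [coeff_tail, coeff_X, h, coeff_one, coeff_zero]
  rw [e]
  split_ifs <;> simp [coeff_X, coeff_zero]

theorem one_add_X_mul_geom (i : Fin m) : (1 + X i) * geom i = 1 := by
  ext w
  cases w with
  | nil => simp [coeff_mul_nil, coeff_add, coeff_one, coeff_X, coeff_geom]
  | cons a w =>
    rw [coeff_one_add_X_mul_cons, coeff_one, coeff_geom, coeff_geom]
    by_cases h : a = i
    · by_cases h' : w = List.replicate w.length i
      · simp [h, List.replicate_succ, ← h', pow_succ]
      · simp [h, List.replicate_succ, h']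
    · simp [h, List.replicate_succ]

theorem geom_mul_one_add_X (i : Fin m) : geom i * (1 + X i) = 1 := by
  have key : ∀ f : NCSeries m, (1 + X i) * f = 0 → f = 0 := by
    intro f hf
    ext w
    induction w with
    | nil =>
      have := congrArg (fun g => coeff g []) hf
      simpa [coeff_mul_nil, coeff_add, coeff_one, coeff_X, coeff_zero] using this
    | cons a w ih =>
      have := congrArg (fun g => coeff g (a :: w)) hf
      simp only [coeff_one_add_X_mul_cons, ih, coeff_zero, ite_self, add_zero] at this
      rw [this, coeff_zero]
  have := key (geom i * (1 + X i) - 1) (by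
    rw [mul_sub, ← mul_assoc, one_add_X_mul_geom, one_mul, mul_one, sub_self])
  exact sub_eq_zero.1 this

/-- The unit `1 + X_i`, with inverse `1 - X_i + X_i ^ 2 - ⋯`. -/
def magnusUnit (i : Fin m) : (NCSeries m)ˣ where
  val := 1 + X i
  inv := geom i
  val_inv := one_add_X_mul_geom i
  inv_val := geom_mul_one_add_X i

/-- The Magnus expansion, the homomorphism with `E(α_i) = 1 + X_i`. -/
def magnus : FreeGroup (Fin m) →* (NCSeries m)ˣ := FreeGroup.lift magnusUnit

end NCSeries

/-- The integer `a` is a value of the welded Milnor invariant `μ^w_σ(j₁ ⋯ j_k i)`, where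
`J = [j₁, …, j_k]`: it is the coefficient of `X_{j₁} ⋯ X_{j_k}` in the Magnus expansion of a word
expressing, for a diagram of `σ` and some `q > k`, the `i`th preferred longitude modulo the `q`th
term of the lower central series. -/
def IsWeldedMilnor {m : ℕ} (σ : WeldedStringLink m) (J : List (Fin m)) (i : Fin m) (a : ℤ) : Prop :=
  ∃ (D : Diagram m) (q : ℕ) (w : FreeGroup (Fin m)), Quot.mk WeldedMove D = σ ∧ J.length < q ∧
    D.IsLongitudeWord q i w ∧ (NCSeries.magnus w : NCSeries m).coeff J = a

end WeldedSL

end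

/-!
Let `Q(n, k)` be the group of noncommutative power series with constant term `1`, modulo those that are
`1` modulo `(n, I ^ k)`, where `I` is the ideal of the series without constant term. It is nilpotent
(`NCSeries.lowerCentralSeries_unipotentQuotient`), and the class in `Q(n, k)` of the Magnus expansion of
a word determines its coefficients of degree less than `k` modulo `n` (`NCSeries.coeff_magnus_modEq`).

The group `G(D)` is generated by its meridians modulo each term of the lower central series, since every
arc is a conjugate of a meridian and conjugation by `v` depends on `v` only up to commutators.
Iterating this conjugation writes the longitudes as words in the meridians
(`Diagram.exists_isLongitudeWord`). In a nilpotent group the iteration becomes stationary, at a solution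
of the Wirtinger relations. Hence for every nilpotent group `B` and all `x` in `B` there is a homomorphism
`G(D) → B` that sends the meridians to `x` (`Diagram.exists_hom`), and its value on a longitude is the value
of any longitude word at `x`. This value is `longitudeValue`; for `B = Q(0, k)` and `x_i = 1 + X_i` its
coefficients are the welded Milnor invariants.

Homomorphisms `G(D) → B` are colourings of `D` by `B`, which can be followed through a local move: it is
enough to look inside the disk, at what each strand does to its colour and contributes to the longitude
(`LocalMove.colouringsTransport`). By uniqueness of the colouring, one direction of each move is enough.
For the welded Reidemeister moves this works in every `B`. For a `V^n`-move the strand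
passing under is conjugated by the `n`-th power of a colour, and all is well if `x_i ^ n = 1`. R1 and
`V^n` also change the framing exponent, which is controlled by an additional abelian colouring in `ℤ/n`
(`ColouringsTransport.exists_hom`).

For a prime `p` the Frobenius congruence `(1 + X_i) ^ p ≡ 1 + X_i ^ p` modulo `p` gives `x_i ^ p = 1` in
`Q(p, p)` (`NCSeries.quotientGen_pow`). Thus the longitudes in `Q(p, p)`, that is, the Magnus coefficients of
degree less than `p` modulo `p`, are invariant under `V^p`-moves.
-/

noncomputable section

/-! ### The Magnus expansion modulo `(n, I ^ k)` -/

namespace WeldedSL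

namespace NCSeries

variable {m : ℕ}

/-- Taking a coefficient, as an additive map. -/
def coeffHom (J : List (Fin m)) : NCSeries m →+ ℤ where
  toFun f := f.coeff J
  map_zero' := rfl
  map_add' _ _ := rfl

theorem coeff_mul (f g : NCSeries m) (J : List (Fin m)) :
    (f * g).coeff J = ∑ k ∈ Finset.range (J.length + 1), f.coeff (J.take k) * g.coeff (J.drop k) :=
  rfl

/-- The two-sided ideal `(n, I ^ k)`, where `I` is the ideal of the series without constant term: the
series all of whose coefficients at words of length less than `k` are divisible by `n`. For `n = 0`
it is `I ^ k`. -/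
def truncIdeal (m n k : ℕ) : AddSubgroup (NCSeries m) where
  carrier := {f | ∀ J : List (Fin m), J.length < k → (n : ℤ) ∣ f.coeff J}
  zero_mem' _ _ := dvd_zero _
  add_mem' hf hg J hJ := dvd_add (hf J hJ) (hg J hJ)
  neg_mem' hf J hJ := (dvd_neg).2 (hf J hJ)

theorem mul_mem_truncIdeal_left {n k : ℕ} (f : NCSeries m) {g : NCSeries m}
    (hg : g ∈ truncIdeal m n k) : f * g ∈ truncIdeal m n k := by
  intro J hJ
  rw [coeff_mul]
  exact Finset.dvd_sum fun i _ =>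
    dvd_mul_of_dvd_right (hg (J.drop i) (by simp only [List.length_drop]; omega)) _

theorem mul_mem_truncIdeal_right {n k : ℕ} {f : NCSeries m} (g : NCSeries m)
    (hf : f ∈ truncIdeal m n k) : f * g ∈ truncIdeal m n k := by
  intro J hJ
  rw [coeff_mul]
  exact Finset.dvd_sum fun i _ =>
    dvd_mul_of_dvd_left (hf (J.take i) (by simp only [List.length_take]; omega)) _

theorem mul_mem_truncIdeal_zero {a b : ℕ} {f g : NCSeries m} (hf : f ∈ truncIdeal m 0 a)
    (hg : g ∈ truncIdeal m 0 b) : f * g ∈ truncIdeal m 0 (a + b) := by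
  intro J hJ
  rw [coeff_mul]
  refine Finset.dvd_sum fun i _ => ?_
  by_cases h : (J.take i).length < a
  · exact dvd_mul_of_dvd_left (hf _ h) _
  · refine dvd_mul_of_dvd_right (hg _ ?_) _
    simp only [List.length_take, List.length_drop] at h ⊢
    omega

theorem truncIdeal_zero_le (m n k : ℕ) : truncIdeal m 0 k ≤ truncIdeal m n k := fun f hf J hJ => by
  have h := hf J hJ
  rw [Nat.cast_zero, zero_dvd_iff] at h
  rw [h]
  exact dvd_zero _

theorem X_mem_truncIdeal (i : Fin m) : X i ∈ truncIdeal m 0 1 := by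
  intro J hJ
  have : J = [] := List.length_eq_zero_iff.1 (by omega)
  subst this
  simp [coeff_X]

/-- The congruence subgroup of the units of the ring of noncommuting power series that are `1` modulo
`(n, I ^ k)`. -/
def congruenceUnits (m n k : ℕ) : Subgroup (NCSeries m)ˣ where
  carrier := {u | (u : NCSeries m) - 1 ∈ truncIdeal m n k}
  one_mem' := by simp [zero_mem]
  mul_mem' {u v} hu hv := by
    have h : ((u * v : (NCSeries m)ˣ) : NCSeries m) - 1 = (u - 1) * v + (v - 1) := by
      rw [Units.val_mul]; noncomm_ring
    simp only [Set.mem_ofPred_eq, h]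
    exact add_mem (mul_mem_truncIdeal_right _ hu) hv
  inv_mem' {u} hu := by
    have h : ((u⁻¹ : (NCSeries m)ˣ) : NCSeries m) - 1 = -((u⁻¹ : (NCSeries m)ˣ) * (u - 1)) := by
      rw [mul_sub, Units.inv_mul]; noncomm_ring
    simp only [Set.mem_ofPred_eq, h]
    exact neg_mem (mul_mem_truncIdeal_left _ hu)

theorem mem_congruenceUnits {n k : ℕ} {u : (NCSeries m)ˣ} :
    u ∈ congruenceUnits m n k ↔ (u : NCSeries m) - 1 ∈ truncIdeal m n k := Iff.rfl

instance (n k : ℕ) : (congruenceUnits m n k).Normal where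
  conj_mem u hu v := by
    have h : ((v * u * v⁻¹ : (NCSeries m)ˣ) : NCSeries m) - 1 =
        v * (u - 1) * (v⁻¹ : (NCSeries m)ˣ) := by
      rw [mul_sub, sub_mul, mul_one, Units.mul_inv]; rfl
    rw [mem_congruenceUnits, h]
    exact mul_mem_truncIdeal_right _ (mul_mem_truncIdeal_left _ hu)

/-- With `u = 1 + a` and `v = 1 + b`, the commutator is `1 + (ab - ba) u⁻¹ v⁻¹`. -/
theorem commutator_mem_congruenceUnits {k : ℕ} {u v : (NCSeries m)ˣ}
    (hu : u ∈ congruenceUnits m 0 k) (hv : v ∈ congruenceUnits m 0 1) :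
    u * v * u⁻¹ * v⁻¹ ∈ congruenceUnits m 0 (k + 1) := by
  rw [mem_congruenceUnits] at *
  have h : ((u * v * u⁻¹ * v⁻¹ : (NCSeries m)ˣ) : NCSeries m) - 1 =
      ((u - 1) * (v - 1) - (v - 1) * (u - 1)) *
        ((u⁻¹ * v⁻¹ : (NCSeries m)ˣ) : NCSeries m) := by
    have e : ((u : NCSeries m) - 1) * (v - 1) - (v - 1) * (u - 1) =
        ((u * v : (NCSeries m)ˣ) : NCSeries m) - ((v * u : (NCSeries m)ˣ) : NCSeries m) := by
      rw [Units.val_mul, Units.val_mul]; noncomm_ring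
    have e' : v * u * (u⁻¹ * v⁻¹) = 1 := by group
    rw [e, sub_mul, ← Units.val_mul, ← Units.val_mul, e', Units.val_one, ← mul_assoc]
  rw [h]
  refine mul_mem_truncIdeal_right _ (sub_mem (mul_mem_truncIdeal_zero hu hv) ?_)
  rw [add_comm]
  exact mul_mem_truncIdeal_zero hv hu

theorem magnusUnit_mem (i : Fin m) : magnusUnit i ∈ congruenceUnits m 0 1 := by
  change (1 + X i) - 1 ∈ truncIdeal m 0 1
  rw [add_sub_cancel_left]
  exact X_mem_truncIdeal i

/-- The Frobenius congruence `(1 + X_i) ^ p ≡ 1 + X_i ^ p` modulo `p`. -/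
theorem magnusUnit_pow_mem {p : ℕ} (hp : p.Prime) (i : Fin m) :
    magnusUnit i ^ p ∈ congruenceUnits m p p := by
  rw [mem_congruenceUnits, Units.val_pow_eq_pow_val]
  change (1 + X i) ^ p - 1 ∈ truncIdeal m p p
  obtain ⟨r, hr⟩ := (Commute.one_left (X i)).exists_add_pow_prime_eq hp
  have hX : ∀ k : ℕ, X i ^ k ∈ truncIdeal m 0 k := by
    intro k
    induction k with
    | zero => intro J hJ; omega
    | succ k ih => rw [pow_succ]; exact mul_mem_truncIdeal_zero ih (X_mem_truncIdeal i)
  rw [hr, one_pow, mul_one, add_assoc, add_sub_cancel_left]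
  refine add_mem (truncIdeal_zero_le m p p (hX p)) ?_
  rw [mul_assoc, ← nsmul_eq_mul]
  intro J _
  change (p : ℤ) ∣ coeffHom J (p • (X i * r))
  rw [map_nsmul, nsmul_eq_mul]
  exact dvd_mul_right _ _

/-- The power series with constant term `1`, modulo those that are `1` modulo `(n, I ^ k)`. -/
abbrev UnipotentQuotient (m n k : ℕ) : Type :=
  congruenceUnits m 0 1 ⧸ (congruenceUnits m n k).subgroupOf (congruenceUnits m 0 1)

/-- The series `1 + X_i`, as an element of the group of the series with constant term `1`. -/
def unipotentGen (i : Fin m) : congruenceUnits m 0 1 := ⟨magnusUnit i, magnusUnit_mem i⟩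

/-- The class of `1 + X_i`. -/
def quotientGen (n k : ℕ) (i : Fin m) : UnipotentQuotient m n k :=
  QuotientGroup.mk (unipotentGen i)

theorem quotientGen_pow {p : ℕ} (hp : p.Prime) (i : Fin m) : quotientGen p p i ^ p = 1 := by
  rw [quotientGen, ← QuotientGroup.mk_pow, QuotientGroup.eq_one_iff, Subgroup.mem_subgroupOf]
  exact magnusUnit_pow_mem hp i

/-- `I ^ (k + 1)` bounds the lower central series, whose first term has index zero here. -/
theorem lowerCentralSeries_unipotentQuotient (m n k : ℕ) :
    (⊤ : Subgroup (UnipotentQuotient m n (k + 1))).lowerCentralSeries k = ⊥ := by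
  set N := (congruenceUnits m n (k + 1)).subgroupOf (congruenceUnits m 0 1)
  have htop : (⊤ : Subgroup (congruenceUnits m 0 1)).map (QuotientGroup.mk' N) = ⊤ :=
    Subgroup.map_top_of_surjective _ (QuotientGroup.mk'_surjective N)
  rw [← htop, ← Subgroup.map_lowerCentralSeries, ← le_bot_iff, Subgroup.map_le_iff_le_comap,
    MonoidHom.comap_bot, QuotientGroup.ker_mk']
  have hd : Subgroup.IsDescendingCentralSeries
      fun k => (congruenceUnits m 0 (k + 1)).subgroupOf (congruenceUnits m 0 1) := by
    refine ⟨Subgroup.subgroupOf_self _, fun u j hu v => ?_⟩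
    exact commutator_mem_congruenceUnits hu v.2
  refine (Subgroup.descending_central_series_ge_lower _ hd k).trans ?_
  exact fun u hu => truncIdeal_zero_le m n _ hu

theorem lift_unipotentGen (w : FreeGroup (Fin m)) :
    (FreeGroup.lift unipotentGen w : (NCSeries m)ˣ) = magnus w := by
  have h : (congruenceUnits m 0 1).subtype.comp (FreeGroup.lift unipotentGen) = magnus := by
    ext i
    simp [magnus, unipotentGen]
  exact DFunLike.congr_fun h w

/-- Words with the same image in the quotient modulo `(n, I ^ k)` have Magnus coefficients that are
congruent modulo `n` in degrees less than `k`. -/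
theorem coeff_magnus_modEq {n k : ℕ} {w w' : FreeGroup (Fin m)}
    (h : FreeGroup.lift (quotientGen n k) w = FreeGroup.lift (quotientGen n k) w')
    {J : List (Fin m)} (hJ : J.length < k) :
    (magnus w : NCSeries m).coeff J ≡ (magnus w' : NCSeries m).coeff J [ZMOD n] := by
  have hl : FreeGroup.lift (quotientGen n k) =
      (QuotientGroup.mk' _).comp (FreeGroup.lift (unipotentGen (m := m))) := by
    ext i
    simp [quotientGen]
  rw [hl, MonoidHom.comp_apply, MonoidHom.comp_apply, QuotientGroup.mk'_apply,
    QuotientGroup.mk'_apply, QuotientGroup.eq, Subgroup.mem_subgroupOf] at h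
  simp only [Subgroup.coe_mul, Subgroup.coe_inv, lift_unipotentGen, mem_congruenceUnits] at h
  have h' := mul_mem_truncIdeal_left (magnus w : NCSeries m) h J hJ
  rw [mul_sub, mul_one, ← Units.val_mul, mul_inv_cancel_left] at h'
  refine (Int.modEq_iff_dvd).2 ?_
  simpa [sub_eq_add_neg, coeff_add, coeff_neg] using h'

end NCSeries
end WeldedSL

/-! ### Homomorphisms from the group of a diagram to nilpotent groups -/

namespace WeldedSL

namespace Diagram

open scoped commutatorElement

variable {m : ℕ} (D : Diagram m) {B : Type*} [Group B]

/-- The product `u_{i1} ⋯ u_{ik}` for a colouring `κ` of the arcs by elements of a group. -/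
def underProduct (κ : D.Arc → B) (i : Fin m) (k : ℕ) : B :=
  ((List.ofFn fun j => κ (D.overArc i j) ^ D.underSign i j).take k).prod

/-- The colouring in which the initial arcs have the colours `x` and every other arc is obtained from
the initial arc of its component by the conjugations that the overpassing arcs impose when
they have the colours `κ`. -/
def recolor (x : Fin m → B) (κ : D.Arc → B) : D.Arc → B := fun a =>
  (D.underProduct κ a.1 a.2)⁻¹ * x a.1 * D.underProduct κ a.1 a.2

/-- The `i`th preferred longitude, read off a colouring of the arcs. -/
def longitudeOf (x : Fin m → B) (κ : D.Arc → B) (i : Fin m) : B :=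
  x i ^ D.framing i * D.underProduct κ i (D.unders i).length

theorem longitude_eq (i : Fin m) :
    D.longitude i = D.longitudeOf D.meridian (PresentedGroup.of (rels := D.relators)) i := by
  rw [longitude, longitudeOf, underProduct, List.take_of_length_le (by simp), map_list_prod,
    List.map_ofFn]
  congr 3

theorem underProduct_succ (κ : D.Arc → B) (i : Fin m) (j : Fin (D.unders i).length) :
    D.underProduct κ i (j + 1) =
      D.underProduct κ i j * κ (D.overArc i j) ^ D.underSign i j := by
  rw [underProduct, List.prod_take_succ _ _ (by simp)]
  simp [underProduct]

variable {C : Type*} [Group C]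

theorem map_underProduct (f : B →* C) (κ : D.Arc → B) (i : Fin m) (k : ℕ) :
    f (D.underProduct κ i k) = D.underProduct (fun a => f (κ a)) i k := by
  simp only [underProduct, map_list_prod, List.map_take, List.map_ofFn, Function.comp_def, map_zpow]

theorem map_recolor (f : B →* C) (x : Fin m → B) (κ : D.Arc → B) (a : D.Arc) :
    f (D.recolor x κ a) = D.recolor (fun i => f (x i)) (fun a => f (κ a)) a := by
  simp only [recolor, map_mul, map_inv, map_underProduct]

theorem map_longitudeOf (f : B →* C) (x : Fin m → B) (κ : D.Arc → B) (i : Fin m) :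
    f (D.longitudeOf x κ i) = D.longitudeOf (fun i => f (x i)) (fun a => f (κ a)) i := by
  simp only [longitudeOf, map_mul, map_zpow, map_underProduct]

theorem recolor_zero (x : Fin m → B) (κ : D.Arc → B) (i : Fin m) :
    D.recolor x κ ⟨i, 0⟩ = x i := by
  simp [recolor, underProduct]

theorem recolor_succ (x : Fin m → B) (κ : D.Arc → B) (i : Fin m)
    (j : Fin (D.unders i).length) :
    D.recolor x κ ⟨i, j.succ⟩ = (κ (D.overArc i j) ^ D.underSign i j)⁻¹ *
      D.recolor x κ ⟨i, j.castSucc⟩ * κ (D.overArc i j) ^ D.underSign i j := by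
  simp only [recolor, Fin.val_succ, Fin.val_castSucc, underProduct_succ]
  group

/-- The Wirtinger relation at an undercrossing. -/
theorem of_succ (i : Fin m) (j : Fin (D.unders i).length) :
    (PresentedGroup.of ⟨i, j.succ⟩ : D.WirtingerGroup) =
      (PresentedGroup.of (D.overArc i j) ^ D.underSign i j)⁻¹ *
        PresentedGroup.of ⟨i, j.castSucc⟩ * PresentedGroup.of (D.overArc i j) ^ D.underSign i j := by
  have h := PresentedGroup.one_of_mem (rels := D.relators) ⟨i, j, rfl⟩
  simp only [map_mul, map_inv, u, map_zpow, mul_assoc] at h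
  rw [inv_mul_eq_one] at h
  exact h.trans (mul_assoc _ _ _).symm

/-- The tautological colouring of the arcs is a fixed point of `recolor`. -/
theorem recolor_of : D.recolor D.meridian (PresentedGroup.of (rels := D.relators)) =
    PresentedGroup.of := by
  funext ⟨i, k⟩
  induction k using Fin.induction with
  | zero => exact D.recolor_zero _ _ i
  | succ j ih => rw [recolor_succ, ih, of_succ]

/-- A fixed point of `recolor` satisfies the Wirtinger relations. -/
def homOfFixed {x : Fin m → B} {κ : D.Arc → B} (h : D.recolor x κ = κ) : D.WirtingerGroup →* B :=
  PresentedGroup.toGroup (f := κ) (by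
    rintro r ⟨i, j, rfl⟩
    have e := D.recolor_succ x κ i j
    rw [h] at e
    simp only [u, map_mul, map_inv, map_zpow, FreeGroup.lift_apply_of, e]
    group)

theorem homOfFixed_of {x : Fin m → B} {κ : D.Arc → B} (h : D.recolor x κ = κ) (a : D.Arc) :
    D.homOfFixed h (PresentedGroup.of a) = κ a :=
  PresentedGroup.toGroup.of _

theorem homOfFixed_meridian {x : Fin m → B} {κ : D.Arc → B} (h : D.recolor x κ = κ) (i : Fin m) :
    D.homOfFixed h (D.meridian i) = x i := by
  rw [meridian, homOfFixed_of, ← h, recolor_zero]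

/-- Recolouring gains one step of the lower central series, because conjugation by `v` and by `v c`
differ by a commutator with `c`. -/
theorem recolor_mem_lowerCentralSeries (x : Fin m → B) {κ κ' : D.Arc → B} {n : ℕ}
    (h : ∀ a, (κ a)⁻¹ * κ' a ∈ (⊤ : Subgroup B).lowerCentralSeries n) (a : D.Arc) :
    (D.recolor x κ a)⁻¹ * D.recolor x κ' a ∈ (⊤ : Subgroup B).lowerCentralSeries (n + 1) := by
  obtain ⟨i, k⟩ := a
  have hv : (D.underProduct κ i k)⁻¹ * D.underProduct κ' i k ∈
      (⊤ : Subgroup B).lowerCentralSeries n := by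
    rw [← QuotientGroup.eq, ← QuotientGroup.mk'_apply, ← QuotientGroup.mk'_apply,
      map_underProduct, map_underProduct]
    congr 1
    funext a
    exact QuotientGroup.eq.2 (h a)
  set v := D.underProduct κ i k
  set v' := D.underProduct κ' i k
  have e : (D.recolor x κ ⟨i, k⟩)⁻¹ * D.recolor x κ' ⟨i, k⟩ =
      ⁅(v⁻¹ * v')⁻¹, (v⁻¹ * x i * v)⁻¹⁆⁻¹ := by
    change (v⁻¹ * x i * v)⁻¹ * (v'⁻¹ * x i * v') = _
    rw [commutatorElement_def]
    group
  rw [e]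
  exact inv_mem (Subgroup.commutator_mem_commutator (inv_mem hv) (Subgroup.mem_top _))

theorem iterate_recolor_mem_lowerCentralSeries (x : Fin m → B) (κ κ' : D.Arc → B) (n : ℕ)
    (a : D.Arc) : ((D.recolor x)^[n] κ a)⁻¹ * (D.recolor x)^[n] κ' a ∈
      (⊤ : Subgroup B).lowerCentralSeries n := by
  induction n generalizing a with
  | zero => exact Subgroup.mem_top _
  | succ n ih =>
    rw [Function.iterate_succ_apply', Function.iterate_succ_apply']
    exact D.recolor_mem_lowerCentralSeries x ih a

theorem map_iterate_recolor (f : B →* C) (x : Fin m → B) (κ : D.Arc → B) (n : ℕ) (a : D.Arc) :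
    f ((D.recolor x)^[n] κ a) = (D.recolor fun i => f (x i))^[n] (fun a => f (κ a)) a := by
  induction n generalizing a with
  | zero => rfl
  | succ n ih =>
    simp only [Function.iterate_succ_apply', map_recolor, ih]

/-- Milnor's approximation of the longitudes by words in the meridians: replace each arc by a
conjugate of its meridian, repeatedly. -/
theorem exists_isLongitudeWord (q : ℕ) (i : Fin m) : ∃ w, D.IsLongitudeWord q i w := by
  set N := (⊤ : Subgroup D.WirtingerGroup).lowerCentralSeries (q - 1)
  refine ⟨D.longitudeOf FreeGroup.of ((D.recolor FreeGroup.of)^[q - 1] 1) i, ?_⟩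
  rw [IsLongitudeWord, longitude_eq, ← QuotientGroup.eq, ← QuotientGroup.mk'_apply,
    ← QuotientGroup.mk'_apply, map_longitudeOf, map_longitudeOf, map_longitudeOf]
  simp only [FreeGroup.lift_apply_of, map_iterate_recolor (f := FreeGroup.lift D.meridian)]
  congr 1
  funext a
  refine QuotientGroup.eq.2 ?_
  have h := D.iterate_recolor_mem_lowerCentralSeries D.meridian
    (fun a => FreeGroup.lift D.meridian ((1 : D.Arc → FreeGroup (Fin m)) a))
    (PresentedGroup.of (rels := D.relators)) (q - 1) a
  rwa [Function.iterate_fixed D.recolor_of] at h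

/-- A nilpotent group receives a homomorphism from `G(D)` with any prescribed values on the
meridians. -/
theorem exists_hom {k : ℕ} (hB : (⊤ : Subgroup B).lowerCentralSeries k = ⊥) (x : Fin m → B) :
    ∃ Φ : D.WirtingerGroup →* B, ∀ i, Φ (D.meridian i) = x i := by
  have h : D.recolor x ((D.recolor x)^[k] 1) = (D.recolor x)^[k] 1 := by
    funext a
    have := D.iterate_recolor_mem_lowerCentralSeries x (D.recolor x 1) 1 k a
    rw [hB, Subgroup.mem_bot, inv_mul_eq_one, ← Function.iterate_succ_apply,
      Function.iterate_succ_apply'] at this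
    exact this
  exact ⟨D.homOfFixed h, D.homOfFixed_meridian h⟩

theorem map_longitude_eq_lift {k q : ℕ} (hB : (⊤ : Subgroup B).lowerCentralSeries k = ⊥)
    (hq : k < q) {x : Fin m → B} {Φ : D.WirtingerGroup →* B} (hΦ : ∀ i, Φ (D.meridian i) = x i)
    {i : Fin m} {w : FreeGroup (Fin m)} (hw : D.IsLongitudeWord q i w) :
    Φ (D.longitude i) = FreeGroup.lift x w := by
  have h := Subgroup.mem_map_of_mem Φ
    (Subgroup.lowerCentralSeries_antitone _ (show k ≤ q - 1 by omega) hw)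
  rw [Subgroup.map_lowerCentralSeries] at h
  have h' : _ ∈ (⊤ : Subgroup B).lowerCentralSeries k :=
    Subgroup.lowerCentralSeries_mono k le_top h
  rw [hB, Subgroup.mem_bot, map_mul, map_inv, inv_mul_eq_one] at h'
  have e : Φ.comp (FreeGroup.lift D.meridian) = FreeGroup.lift x := by
    ext i
    simp [hΦ]
  rw [← h', ← e, MonoidHom.comp_apply]

end Diagram
end WeldedSL

/-! ### Colourings -/

namespace WeldedSL

section Colouring

variable {B : Type*} [Group B]

/-- The contribution of a passage to the longitude, when `g` gives each crossing the colour of its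
overpass. -/
def passageFactor (g : ℕ → B) (e : Passage) : B :=
  if e.isOver then 1 else g e.label ^ (e.sign : ℤ)

/-- The contribution of a piece of strand to the longitude. -/
def wordProduct (g : ℕ → B) (l : List Passage) : B := (l.map (passageFactor g)).prod

/-- A strand that starts with the colour `z` and reads the word `l` has the colour `g c` when it passes
over the crossing `c`. -/
def IsStrandColouring (g : ℕ → B) : B → List Passage → Prop
  | _, [] => True
  | z, e :: l => (e.isOver = true → g e.label = z) ∧
      IsStrandColouring g ((passageFactor g e)⁻¹ * z * passageFactor g e) l

theorem passageFactor_of_isOver (g : ℕ → B) {e : Passage} (h : e.isOver = true) :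
    passageFactor g e = 1 := by
  simp [passageFactor, h]

@[simp] theorem passageFactor_O (g : ℕ → B) (c : ℕ) (ε : ℤˣ) : passageFactor g (O c ε) = 1 := rfl

@[simp] theorem passageFactor_U (g : ℕ → B) (c : ℕ) (ε : ℤˣ) :
    passageFactor g (U c ε) = g c ^ (ε : ℤ) := rfl

@[simp] theorem wordProduct_nil (g : ℕ → B) : wordProduct g [] = 1 := rfl

@[simp] theorem wordProduct_cons (g : ℕ → B) (e : Passage) (l : List Passage) :
    wordProduct g (e :: l) = passageFactor g e * wordProduct g l := by
  simp [wordProduct]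

theorem wordProduct_append (g : ℕ → B) (l l' : List Passage) :
    wordProduct g (l ++ l') = wordProduct g l * wordProduct g l' := by
  simp [wordProduct]

theorem wordProduct_filter (g : ℕ → B) (l : List Passage) :
    wordProduct g (l.filter fun e => !e.isOver) = wordProduct g l := by
  induction l with
  | nil => rfl
  | cons e l ih =>
    cases h : e.isOver with
    | false => simp [h, ih]
    | true => simp [h, ih, passageFactor_of_isOver g h]

@[simp] theorem isStrandColouring_nil (g : ℕ → B) (z : B) : IsStrandColouring g z [] := trivial

theorem isStrandColouring_cons (g : ℕ → B) (z : B) (e : Passage) (l : List Passage) :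
    IsStrandColouring g z (e :: l) ↔ (e.isOver = true → g e.label = z) ∧
      IsStrandColouring g ((passageFactor g e)⁻¹ * z * passageFactor g e) l := Iff.rfl

@[simp] theorem isStrandColouring_O (g : ℕ → B) (z : B) (c : ℕ) (ε : ℤˣ) (l : List Passage) :
    IsStrandColouring g z (O c ε :: l) ↔ g c = z ∧ IsStrandColouring g z l := by
  simp [isStrandColouring_cons, O, passageFactor]

@[simp] theorem isStrandColouring_U (g : ℕ → B) (z : B) (c : ℕ) (ε : ℤˣ) (l : List Passage) :
    IsStrandColouring g z (U c ε :: l) ↔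
      IsStrandColouring g ((g c ^ (ε : ℤ))⁻¹ * z * g c ^ (ε : ℤ)) l := by
  simp [isStrandColouring_cons, U, passageFactor]

theorem isStrandColouring_append (g : ℕ → B) (z : B) (l l' : List Passage) :
    IsStrandColouring g z (l ++ l') ↔ IsStrandColouring g z l ∧
      IsStrandColouring g ((wordProduct g l)⁻¹ * z * wordProduct g l) l' := by
  induction l generalizing z with
  | nil => simp
  | cons e l ih =>
    simp only [List.cons_append, isStrandColouring_cons, ih, wordProduct_cons, mul_inv_rev,
      and_assoc, mul_assoc]

theorem isStrandColouring_iff (g : ℕ → B) (z : B) (l : List Passage) :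
    IsStrandColouring g z l ↔ ∀ l₁ e l₂, l = l₁ ++ e :: l₂ → e.isOver = true →
      g e.label = (wordProduct g l₁)⁻¹ * z * wordProduct g l₁ := by
  constructor
  · rintro h l₁ e l₂ rfl he
    exact ((isStrandColouring_append g z l₁ _).1 h).2.1 he
  · induction l generalizing z with
    | nil => simp
    | cons e l ih =>
      intro h
      refine ⟨fun he => by simpa using h [] e l rfl he, ih _ fun l₁ e' l₂ hl he' => ?_⟩
      rw [h (e :: l₁) e' l₂ (by rw [hl]; rfl) he', wordProduct_cons]
      group

end Colouring

namespace Diagram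

variable {m : ℕ} (D : Diagram m) {B : Type*} [Group B]

/-- A colouring of the arcs of `D` by elements of a group, subject to the Wirtinger relations, with
the initial colours `x`. It is encoded by the colours `g c` of the overpasses of the crossings `c`. -/
def IsColouring (x : Fin m → B) (g : ℕ → B) : Prop :=
  ∀ i, IsStrandColouring g (x i) (D.strand i)

theorem isOverArc_unique {c : ℕ} {a a' : D.Arc} (h : D.IsOverArc c a) (h' : D.IsOverArc c a') :
    a = a' := by
  obtain ⟨i, k⟩ := a
  obtain ⟨i', k'⟩ := a'
  obtain ⟨l₁, l₂, e, hl, hc, he, hk⟩ := h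
  obtain ⟨l₁', l₂', e', hl', hc', he', hk'⟩ := h'
  dsimp only at hl hl' hk hk'
  have hee : (e.label, e.isOver) = (e'.label, e'.isOver) := by rw [hc, hc', he, he']
  have hn := D.nodup
  rw [List.map_flatMap, List.nodup_flatMap] at hn
  have hi : i = i' := by
    by_contra hne
    have hs : Std.Symm (Function.onFun List.Disjoint
        fun i => (D.strand i).map fun e => (e.label, e.isOver)) := ⟨fun _ _ h => h.symm⟩
    have := hn.2.forall (List.mem_finRange i) (List.mem_finRange i') hne
    exact this (a := (e.label, e.isOver)) (List.mem_map.2 ⟨e, by simp [hl], rfl⟩)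
      (List.mem_map.2 ⟨e', by simp [hl'], hee.symm⟩)
  subst hi
  have hlen : l₁.length = l₁'.length := by
    have hni := hn.1 i (List.mem_finRange i)
    have h1 : l₁.length < (D.strand i).length := by simp [hl]
    have h2 : l₁'.length < (D.strand i).length := by simp [hl']
    refine (hni.getElem_inj_iff (hi := by simpa using h1) (hj := by simpa using h2)).1 ?_
    have e1 : (D.strand i)[l₁.length] = e := by simp [hl]
    have e2 : (D.strand i)[l₁'.length] = e' := by simp [hl']
    rw [List.getElem_map, List.getElem_map, e1, e2, hee]
  have : l₁ = l₁' := (List.append_inj (hl.symm.trans hl') hlen).1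
  congr 1
  exact Fin.ext (by rw [hk, hk', this])

/-- The arc of an overpass: the underpasses before it are the first ones on the component. -/
theorem exists_isOverArc_of_eq {i : Fin m} {l₁ l₂ : List Passage} {e : Passage}
    (hl : D.strand i = l₁ ++ e :: l₂) (he : e.isOver = true) :
    ∃ k, D.IsOverArc e.label ⟨i, k⟩ ∧
      (D.unders i).take k = l₁.filter fun e => !e.isOver := by
  have h : D.unders i = (l₁.filter fun e => !e.isOver) ++ (e :: l₂).filter fun e => !e.isOver := by
    rw [unders, hl, List.filter_append]
  exact ⟨⟨(l₁.filter fun e => !e.isOver).length, by rw [h, List.length_append]; omega⟩,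
    ⟨l₁, l₂, e, hl, rfl, he, rfl⟩, by simp [h]⟩

theorem underProduct_eq_wordProduct {κ : D.Arc → B} {g : ℕ → B}
    (h : ∀ c a, D.IsOverArc c a → g c = κ a) (i : Fin m) (k : ℕ) :
    D.underProduct κ i k = wordProduct g ((D.unders i).take k) := by
  have e : (List.ofFn fun j => κ (D.overArc i j) ^ D.underSign i j) =
      (D.unders i).map (passageFactor g) := by
    conv_rhs => rw [← List.ofFn_get (D.unders i), List.map_ofFn]
    congr 1
    funext j
    have hj : ((D.unders i).get j).isOver = false := by
      simpa using (List.mem_filter.1 (List.get_mem (D.unders i) j)).2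
    rw [← h _ (D.overArc i j) (Classical.choose_spec (D.exists_isOverArc i j)), Function.comp_apply,
      passageFactor, hj]
    rfl
  rw [underProduct, e, wordProduct, List.map_take]

theorem longitudeOf_eq_wordProduct {κ : D.Arc → B} {g : ℕ → B}
    (h : ∀ c a, D.IsOverArc c a → g c = κ a) (x : Fin m → B) (i : Fin m) :
    D.longitudeOf x κ i = x i ^ D.framing i * wordProduct g (D.strand i) := by
  rw [longitudeOf, D.underProduct_eq_wordProduct h, List.take_length, unders, wordProduct_filter]

theorem exists_hom_of_isColouring {x : Fin m → B} {g : ℕ → B} (hg : D.IsColouring x g) :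
    ∃ Φ : D.WirtingerGroup →* B, (∀ i, Φ (D.meridian i) = x i) ∧
      ∀ i, Φ (D.longitude i) = x i ^ D.framing i * wordProduct g (D.strand i) := by
  set κ : D.Arc → B := fun a => (wordProduct g ((D.unders a.1).take a.2))⁻¹ * x a.1 *
    wordProduct g ((D.unders a.1).take a.2)
  have hκ : ∀ c a, D.IsOverArc c a → g c = κ a := by
    rintro _ ⟨i, k⟩ ⟨l₁, l₂, e, hl, rfl, he, hk⟩
    obtain ⟨k', hk', ht⟩ := D.exists_isOverArc_of_eq hl he
    have : k = k' := by
      simpa using D.isOverArc_unique ⟨l₁, l₂, e, hl, rfl, he, hk⟩ hk'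
    subst this
    simp only [κ, ht, wordProduct_filter]
    exact (isStrandColouring_iff g _ _).1 (hg i) l₁ e l₂ hl he
  have hf : D.recolor x κ = κ := by
    funext a
    rw [recolor, D.underProduct_eq_wordProduct hκ]
  refine ⟨D.homOfFixed hf, D.homOfFixed_meridian hf, fun i => ?_⟩
  rw [longitude_eq, map_longitudeOf]
  simp only [homOfFixed_meridian, homOfFixed_of]
  exact D.longitudeOf_eq_wordProduct hκ x i

theorem exists_isColouring_of_hom {x : Fin m → B} {Φ : D.WirtingerGroup →* B}
    (hΦ : ∀ i, Φ (D.meridian i) = x i) : ∃ g, D.IsColouring x g ∧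
      ∀ i, Φ (D.longitude i) = x i ^ D.framing i * wordProduct g (D.strand i) := by
  classical
  set κ : D.Arc → B := fun a => Φ (PresentedGroup.of a)
  have hf : D.recolor x κ = κ := by
    funext a
    have := D.map_recolor Φ D.meridian (PresentedGroup.of (rels := D.relators)) a
    rw [recolor_of] at this
    simp only [hΦ] at this
    exact this.symm
  set g : ℕ → B := fun c => if h : ∃ a, D.IsOverArc c a then κ h.choose else 1
  have hg : ∀ c a, D.IsOverArc c a → g c = κ a := by
    intro c a h
    have h' : ∃ a, D.IsOverArc c a := ⟨a, h⟩
    simp only [g, dif_pos h']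
    rw [D.isOverArc_unique h'.choose_spec h]
  refine ⟨g, fun i => (isStrandColouring_iff g _ _).2 fun l₁ e l₂ hl he => ?_, fun i => ?_⟩
  · obtain ⟨k, hk, ht⟩ := D.exists_isOverArc_of_eq hl he
    rw [hg _ _ hk, ← hf, recolor, D.underProduct_eq_wordProduct hg, ht, wordProduct_filter]
  · rw [longitude_eq, map_longitudeOf]
    simp only [hΦ]
    exact D.longitudeOf_eq_wordProduct hg x i

end Diagram
end WeldedSL

/-! ### Colourings and local moves -/

namespace WeldedSL

variable {m : ℕ}

section LocalMoves

variable {B : Type*} [Group B]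

/-- Colourings inside the holes of a word that have the same final colour and, up to a power of the
initial colour, the same contribution to the longitude extend to the whole word. A power of the
initial colour in the middle of the word can be moved to its beginning, where it is a power of the
initial colour of the word. -/
theorem isStrandColouring_fill {k : ℕ} {x y : Fin k → List Passage} {g g' : ℕ → B}
    (hx : ∀ h z, IsStrandColouring g z (y h) → IsStrandColouring g' z (x h) ∧
      ∃ s : ℤ, wordProduct g' (x h) = z ^ s * wordProduct g (y h))
    (L : List (Passage ⊕ Fin k)) (hL : ∀ e, Sum.inl e ∈ L → g' e.label = g e.label) (z : B)
    (hz : IsStrandColouring g z (L.flatMap (Sum.elim (fun e => [e]) y))) :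
    IsStrandColouring g' z (L.flatMap (Sum.elim (fun e => [e]) x)) ∧
      ∃ s : ℤ, wordProduct g' (L.flatMap (Sum.elim (fun e => [e]) x)) =
        z ^ s * wordProduct g (L.flatMap (Sum.elim (fun e => [e]) y)) := by
  induction L generalizing z with
  | nil => exact ⟨trivial, 0, by simp⟩
  | cons a L ih =>
    rw [List.flatMap_cons, isStrandColouring_append] at hz
    rw [List.flatMap_cons, isStrandColouring_append, List.flatMap_cons, wordProduct_append,
      wordProduct_append]
    have ha : IsStrandColouring g' z (Sum.elim (fun e => [e]) x a) ∧
        ∃ s : ℤ, wordProduct g' (Sum.elim (fun e => [e]) x a) =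
          z ^ s * wordProduct g (Sum.elim (fun e => [e]) y a) := by
      cases a with
      | inl e =>
        have he := hL e List.mem_cons_self
        refine ⟨⟨fun h => he.trans (hz.1.1 h), trivial⟩, 0, ?_⟩
        simp [passageFactor, he]
      | inr h => exact hx h z hz.1
    obtain ⟨h1, s, hs⟩ := ha
    set v := wordProduct g (Sum.elim (fun e => [e]) y a)
    have hc : (z ^ s * v)⁻¹ * z * (z ^ s * v) = v⁻¹ * z * v := by group
    obtain ⟨h2, r, hr⟩ := ih (fun e he => hL e (List.mem_cons_of_mem _ he)) _ hz.2
    rw [hs, hc]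
    refine ⟨⟨h1, h2⟩, s + r, ?_⟩
    have hp : (v⁻¹ * z * v) ^ r = v⁻¹ * z ^ r * v := by
      simpa using conj_zpow (a := v⁻¹) (b := z) (i := r)
    rw [hr, hp]
    group

/-- Each colouring of `D'` with initial colours of order dividing `n` gives a colouring of `D` with
the same initial colours and, up to powers of the initial colours, the same longitudes. -/
def ColouringsTransport (n : ℕ) (D D' : Diagram m) : Prop :=
  ∀ (B : Type) [Group B] (x : Fin m → B), (∀ i, x i ^ n = 1) → ∀ g, D'.IsColouring x g →
    ∃ g', D.IsColouring x g' ∧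
      ∀ i, ∃ s : ℤ, wordProduct g' (D.strand i) = x i ^ s * wordProduct g (D'.strand i)

theorem exists_inr_mem {k : ℕ} {C : Fin m → List (Passage ⊕ Fin k)}
    (hC : ((List.finRange m).flatMap fun i => (C i).filterMap Sum.getRight?).Perm
      (List.finRange k)) (h : Fin k) : ∃ i, Sum.inr h ∈ C i := by
  have := hC.symm.subset (List.mem_finRange h)
  simpa [List.mem_flatMap] using this

/-- No passage occurs in two different letters of the words that fill up to a diagram. -/
theorem eq_of_mem_fill {k : ℕ} {C : Fin m → List (Passage ⊕ Fin k)} {y : Fin k → List Passage}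
    {D : Diagram m} (hD : D.strand = fill C y) {s s' : Passage ⊕ Fin k} {i i' : Fin m}
    (hs : s ∈ C i) (hs' : s' ∈ C i') {e e' : Passage} (he : e ∈ Sum.elim (fun e => [e]) y s)
    (he' : e' ∈ Sum.elim (fun e => [e]) y s') (hl : e.label = e'.label)
    (ho : e.isOver = e'.isOver) : s = s' := by
  by_contra hne
  set F : Passage ⊕ Fin k → List (ℕ × Bool) := fun a =>
    (Sum.elim (fun e => [e]) y a).map fun e => (e.label, e.isOver)
  have hn : (((List.finRange m).flatMap C).flatMap F).Nodup := by
    have := D.nodup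
    rw [hD] at this
    simpa [fill, F, List.flatMap_assoc, List.map_flatMap] using this
  have hF : Std.Symm (Function.onFun List.Disjoint F) := ⟨fun _ _ h => h.symm⟩
  refine (List.nodup_flatMap.1 hn).2.forall
    (List.mem_flatMap.2 ⟨i, List.mem_finRange _, hs⟩)
    (List.mem_flatMap.2 ⟨i', List.mem_finRange _, hs'⟩) hne
    (List.mem_map.2 ⟨e, he, rfl⟩) (List.mem_map.2 ⟨e', he', ?_⟩)
  rw [hl, ho]

/-- A local move transports colourings if it does so inside the disk, where the colours of the
crossings that lie in the disk may change. -/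
theorem LocalMove.colouringsTransport {n k : ℕ} {x y : Fin k → List Passage} {D D' : Diagram m}
    (hD : LocalMove x y D D')
    (H : ∀ (B : Type) [Group B] (g : ℕ → B),
      (∀ h, ∃ z, z ^ n = 1 ∧ IsStrandColouring g z (y h)) →
      ∃ g' : ℕ → B, (∀ c, g' c = g c ∨ ∀ o, ∃ h, ∃ e ∈ y h, e.label = c ∧ e.isOver = o) ∧
        ∀ h z, IsStrandColouring g z (y h) → IsStrandColouring g' z (x h) ∧
          ∃ s : ℤ, wordProduct g' (x h) = z ^ s * wordProduct g (y h)) :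
    ColouringsTransport n D D' := by
  intro B _ X hX g hg
  obtain ⟨C, hC, h1, h2⟩ := hD
  obtain ⟨g', hc, hh⟩ := H B g fun h => by
    obtain ⟨i, hi⟩ := exists_inr_mem hC h
    obtain ⟨L, L', hL⟩ := List.append_of_mem hi
    have := hg i
    rw [h2, fill, hL, List.flatMap_append, List.flatMap_cons, isStrandColouring_append,
      isStrandColouring_append] at this
    refine ⟨_, ?_, this.2.1⟩
    set v := wordProduct g (L.flatMap (Sum.elim (fun e => [e]) y))
    have := conj_pow (a := v⁻¹) (b := X i) (i := n)
    rwa [inv_inv, hX, mul_one, inv_mul_cancel] at this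
  have hi : ∀ i, _ := fun i => isStrandColouring_fill hh (C i) (fun e he => (hc e.label).resolve_right
    fun hcon => by
      obtain ⟨h, e', he', hl, ho⟩ := hcon e.isOver
      obtain ⟨j, hj⟩ := exists_inr_mem hC h
      exact Sum.inr_ne_inl (eq_of_mem_fill h2 hj he he' (List.mem_singleton_self e) hl ho))
      (X i) (by
        have := hg i
        rwa [h2] at this)
  rw [h2]
  refine ⟨g', fun i => ?_, fun i => ?_⟩
  · rw [h1]; exact (hi i).1
  · rw [h1]; exact (hi i).2

/-- The case of `LocalMove.colouringsTransport` in which no colour changes. -/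
theorem LocalMove.colouringsTransport_of_eq {n k : ℕ} {x y : Fin k → List Passage}
    {D D' : Diagram m} (hD : LocalMove x y D D')
    (H : ∀ (B : Type) [Group B] (g : ℕ → B),
      (∀ h, ∃ z, z ^ n = 1 ∧ IsStrandColouring g z (y h)) →
        ∀ h z, IsStrandColouring g z (y h) → IsStrandColouring g z (x h) ∧
          ∃ s : ℤ, wordProduct g (x h) = z ^ s * wordProduct g (y h)) :
    ColouringsTransport n D D' :=
  hD.colouringsTransport fun B _ g hg => ⟨g, fun _ => Or.inl rfl, H B g hg⟩

end LocalMoves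

theorem exists_zpow_mul_of_eq {B : Type*} [Group B] {z a b : B} (h : a = b) :
    ∃ s : ℤ, a = z ^ s * b := ⟨0, by simp [h]⟩

/-- In R3 the colour of the crossing of the middle over the bottom strand is conjugated by the colour
of the top strand, with an exponent that depends only on `η` and the orientation of the top strand. -/
theorem colouringsTransport_r3 {a d c : ℕ} {η t n b : ℤˣ} {D D' : Diagram m}
    (h : LocalMove
        ![orient t [O a (η * t * n), O d (η * t * b)],
          orient n [U a (η * t * n), O c (η * n * b)],
          orient b [U d (η * t * b), U c (η * n * b)]]
        ![orient t [O d (η * t * b), O a (η * t * n)],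
          orient n [O c (η * n * b), U a (η * t * n)],
          orient b [U c (η * n * b), U d (η * t * b)]] D D') :
    ColouringsTransport 0 D D' := by
  -- the overpass at `c` lies in another hole than those at `a` and `d`
  have hne : c ≠ a ∧ c ≠ d := by
    obtain ⟨C, hC, -, h2⟩ := h
    obtain ⟨i, hi⟩ := exists_inr_mem hC 0
    obtain ⟨j, hj⟩ := exists_inr_mem hC 1
    constructor
    · rintro rfl
      have := eq_of_mem_fill (e := O c (η * t * n)) (e' := O c (η * n * b)) h2 hi hj
        (by simp [orient]; split_ifs <;> simp) (by simp [orient]; split_ifs <;> simp) rfl rfl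
      simp at this
    · rintro rfl
      have := eq_of_mem_fill (e := O c (η * t * b)) (e' := O c (η * n * b)) h2 hi hj
        (by simp [orient]; split_ifs <;> simp) (by simp [orient]; split_ifs <;> simp) rfl rfl
      simp at this
  obtain ⟨hca, hcd⟩ := hne
  refine h.colouringsTransport fun B _ g hg => ?_
  obtain ⟨y, -, hy⟩ := hg 0
  have hda : g d = g a := by
    simp only [Matrix.cons_val_zero, orient] at hy
    split_ifs at hy <;> simp at hy <;> rw [hy.1, hy.2]
  refine ⟨Function.update g c (g a ^ (-((η * t : ℤˣ) : ℤ)) * g c * g a ^ ((η * t : ℤˣ) : ℤ)),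
    fun e => ?_, fun h z => ?_⟩
  · by_cases he : e = c
    · refine Or.inr fun o => ?_
      subst he
      cases o
      · exact ⟨2, U e (η * n * b), by simp [orient]; split_ifs <;> simp, rfl, rfl⟩
      · exact ⟨1, O e (η * n * b), by simp [orient]; split_ifs <;> simp, rfl, rfl⟩
    · exact Or.inl (Function.update_of_ne he _ _)
  · have ha := Function.update_of_ne hca.symm
      (g a ^ (-((η * t : ℤˣ) : ℤ)) * g c * g a ^ ((η * t : ℤˣ) : ℤ)) g
    have hd := Function.update_of_ne hcd.symm
      (g a ^ (-((η * t : ℤˣ) : ℤ)) * g c * g a ^ ((η * t : ℤˣ) : ℤ)) g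
    have hc := Function.update_self c
      (g a ^ (-((η * t : ℤˣ) : ℤ)) * g c * g a ^ ((η * t : ℤˣ) : ℤ)) g
    generalize Function.update g c
      (g a ^ (-((η * t : ℤˣ) : ℤ)) * g c * g a ^ ((η * t : ℤˣ) : ℤ)) = g' at ha hd hc ⊢
    rw [hda] at hd
    fin_cases h
    · refine fun hz => ⟨?_, exists_zpow_mul_of_eq ?_⟩
      · revert hz
        rcases Int.units_eq_one_or t with rfl | rfl <;> simp [orient, ha, hd, hda]
      · rcases Int.units_eq_one_or t with rfl | rfl <;> simp [orient]
    · refine fun hz => ⟨?_, exists_zpow_mul_of_eq ?_⟩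
      · revert hz
        rcases Int.units_eq_one_or n with rfl | rfl
        · simp [orient, ha, hc]
        · simp only [Fin.mk_one, Matrix.cons_val_one, Matrix.cons_val_zero, orient]
          simp [ha, hc]
          intro h
          rw [h]
          group
      · rcases Int.units_eq_one_or n with rfl | rfl <;> simp [orient, ha]
    · refine fun hz => ⟨?_, exists_zpow_mul_of_eq ?_⟩
      · rcases Int.units_eq_one_or b with rfl | rfl <;> simp [orient]
      · have hp (s : ℤ) : ((g a ^ (((η * t : ℤˣ) : ℤ)))⁻¹ * g c * g a ^ ((η * t : ℤˣ) : ℤ)) ^ s =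
            (g a ^ (((η * t : ℤˣ) : ℤ)))⁻¹ * g c ^ s * g a ^ ((η * t : ℤˣ) : ℤ) := by
          simpa using conj_zpow (a := (g a ^ ((η * t : ℤˣ) : ℤ))⁻¹) (b := g c) (i := s)
        rw [zpow_neg] at hc
        rcases Int.units_eq_one_or b with rfl | rfl <;>
          simp [-Units.val_mul, -zpow_neg, orient, hd, hda, hc, hp] <;> group

theorem WeldedMove.colouringsTransport {D D' : Diagram m} (h : WeldedMove D D') :
    ColouringsTransport 0 D D' := by
  cases h with
  | rename f h =>
    intro B _ x _ g hg
    have hs : ∀ l z, IsStrandColouring g z (l.map fun e => ⟨f e.label, e.isOver, e.sign⟩) ↔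
        IsStrandColouring (g ∘ f) z l := by
      intro l
      induction l with
      | nil => simp
      | cons e l ih => intro z; simp only [List.map_cons, isStrandColouring_cons, ih]; rfl
    refine ⟨g ∘ f, fun i => ?_, fun i => exists_zpow_mul_of_eq ?_⟩
    · rw [← hs, ← h]
      exact hg i
    · rw [h, wordProduct, wordProduct, List.map_map]
      rfl
  | r1_over_under c ε h =>
    refine h.colouringsTransport_of_eq fun B _ g _ h z => ?_
    fin_cases h
    simp only [Fin.zero_eta, Matrix.cons_val_fin_one, isStrandColouring_O, wordProduct_cons,
      passageFactor_O, passageFactor_U, wordProduct_nil]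
    rintro ⟨rfl, -⟩
    exact ⟨trivial, -ε, by group⟩
  | r1_under_over c ε h =>
    refine h.colouringsTransport_of_eq fun B _ g _ h z => ?_
    fin_cases h
    simp only [Fin.zero_eta, Matrix.cons_val_fin_one, isStrandColouring_O, isStrandColouring_U,
      wordProduct_cons, passageFactor_O, passageFactor_U, wordProduct_nil]
    rintro ⟨h, -⟩
    -- the colour `g c` commutes with the conjugating element, hence equals the initial colour
    have hz : z = g c := by
      calc z = g c ^ (ε : ℤ) * ((g c ^ (ε : ℤ))⁻¹ * z * g c ^ (ε : ℤ)) * (g c ^ (ε : ℤ))⁻¹ := by group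
        _ = g c ^ (ε : ℤ) * g c * (g c ^ (ε : ℤ))⁻¹ := by rw [← h]
        _ = g c := by group
    exact ⟨trivial, -ε, by rw [hz]; group⟩
  | r2_parallel c d ε h =>
    refine h.colouringsTransport_of_eq fun B _ g hg h z => ?_
    obtain ⟨y, -, hy⟩ := hg 0
    simp at hy
    fin_cases h <;> intro _ <;> refine ⟨trivial, exists_zpow_mul_of_eq ?_⟩ <;> simp [hy]
  | r2_antiparallel c d ε h =>
    refine h.colouringsTransport_of_eq fun B _ g hg h z => ?_
    obtain ⟨y, -, hy⟩ := hg 0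
    simp at hy
    fin_cases h <;> intro _ <;> refine ⟨trivial, exists_zpow_mul_of_eq ?_⟩ <;> simp [hy]
  | r3 a d c η t n b h => exact colouringsTransport_r3 h
  | oc c d ε δ h =>
    refine h.colouringsTransport_of_eq fun B _ g hg h z => ?_
    fin_cases h
    simpa using fun h1 h2 => ⟨⟨h2, h1⟩, 0, by simp⟩

/-- The overpasses of a `V^n`-move have the same colour, whose `n`th power is trivial. -/
theorem VMove.colouringsTransport {n : ℕ} {D D' : Diagram m} (h : VMove n D D') :
    ColouringsTransport n D D' := by
  obtain ⟨c, ε, h⟩ := h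
  refine h.colouringsTransport_of_eq fun B _ g hg h z => ?_
  have hover : ∀ (z : B) (l : List ℕ), (IsStrandColouring g z (l.map fun c => O c ε) →
      ∀ c ∈ l, g c = z) ∧ wordProduct g (l.map fun c => O c ε) = 1 := by
    intro z l
    induction l with
    | nil => simp
    | cons c l ih => simpa [ih.2] using fun h1 h2 => ⟨h1, ih.1 h2⟩
  have hunder : ∀ (z : B) (l : List ℕ), (∀ c ∈ l, g c = z) →
      wordProduct g (l.map fun c => U c ε) = (z ^ (ε : ℤ)) ^ l.length := by
    intro z l
    induction l with
    | nil => simp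
    | cons c l ih =>
      intro h
      simp only [List.mem_cons, forall_eq_or_imp] at h
      simp [ih h.2, h.1, pow_succ']
  have hO : (List.ofFn fun j => O (c j) ε) = (List.ofFn c).map fun c => O c ε := by
    rw [List.map_ofFn]; rfl
  have hU : (List.ofFn fun j => U (c j) ε) = (List.ofFn c).map fun c => U c ε := by
    rw [List.map_ofFn]; rfl
  rw [hO, hU] at hg ⊢
  obtain ⟨y, hn, hy⟩ := hg 0
  intro _
  fin_cases h
  · exact ⟨trivial, exists_zpow_mul_of_eq (hover 1 _).2.symm⟩
  · refine ⟨trivial, exists_zpow_mul_of_eq ?_⟩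
    refine Eq.trans ?_ (hunder y _ ((hover y _).1 hy)).symm
    rw [List.length_ofFn, ← zpow_natCast, ← zpow_mul, mul_comm, zpow_mul, zpow_natCast, hn,
      one_zpow]
    rfl

end WeldedSL

/-! ### Longitudes in nilpotent groups -/

namespace WeldedSL

variable {m : ℕ}

namespace Diagram

variable (D : Diagram m)

/-- The preferred longitude has exponent sum zero in the arcs of its own component. -/
theorem map_longitude_eq_one {A : Type*} [CommGroup A] (t : A) (i : Fin m)
    {Ψ : D.WirtingerGroup →* A} (hΨ : ∀ j, Ψ (D.meridian j) = if j = i then t else 1) :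
    Ψ (D.longitude i) = 1 := by
  have ha : ∀ a : D.Arc, Ψ (PresentedGroup.of a) = if a.1 = i then t else 1 := by
    intro a
    rw [← congrFun D.recolor_of a, map_recolor, recolor, mul_right_comm, inv_mul_cancel, one_mul,
      hΨ]
  have hprod : ∏ j, Ψ (PresentedGroup.of (D.overArc i j)) ^ D.underSign i j =
      t ^ ∑ j, if (D.overArc i j).1 = i then D.underSign i j else 0 := by
    have hz : ∀ f : Fin (D.unders i).length → ℤ, t ^ ∑ j, f j = ∏ j, t ^ f j := fun f => by
      have := map_prod (zpowersHom A t) (fun j => Multiplicative.ofAdd (f j)) Finset.univ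
      simpa only [← ofAdd_sum, zpowersHom_apply, toAdd_ofAdd] using this
    rw [hz]
    refine Finset.prod_congr rfl fun j _ => ?_
    rw [ha]
    split_ifs <;> simp
  rw [longitude_eq, map_longitudeOf, longitudeOf, hΨ, if_pos rfl, underProduct,
    List.take_of_length_le (by simp), List.prod_ofFn, hprod, framing, zpow_neg, inv_mul_cancel]

/-- The homomorphism that counts the arcs of the `i`th component. -/
theorem exists_hom_component {A : Type*} [CommGroup A] (t : A) (i : Fin m) :
    ∃ Ψ : D.WirtingerGroup →* A, ∀ j, Ψ (D.meridian j) = if j = i then t else 1 := by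
  have h : D.recolor (fun j => if j = i then t else 1) (fun a => if a.1 = i then t else 1) =
      fun a => if a.1 = i then t else 1 := by
    funext a
    rw [recolor, mul_right_comm, inv_mul_cancel, one_mul]
  exact ⟨D.homOfFixed h, D.homOfFixed_meridian h⟩

end Diagram

/-- Colourings in `B × ℤ/n` control the framing: the second coordinate of a preferred longitude is
trivial on both sides, so that the two preferred longitudes in `B` differ by the `n`-th power of a
meridian. -/
theorem ColouringsTransport.exists_hom {n : ℕ} {D D' : Diagram m} (h : ColouringsTransport n D D')
    {B : Type} [Group B] {x : Fin m → B} (hx : ∀ i, x i ^ n = 1) {Φ' : D'.WirtingerGroup →* B}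
    (hΦ' : ∀ j, Φ' (D'.meridian j) = x j) (i : Fin m) :
    ∃ Φ : D.WirtingerGroup →* B, (∀ j, Φ (D.meridian j) = x j) ∧
      Φ (D.longitude i) = Φ' (D'.longitude i) := by
  set t : Multiplicative (ZMod n) := Multiplicative.ofAdd 1
  have ht : ∀ s : ℤ, t ^ s = 1 ↔ (n : ℤ) ∣ s := by
    intro s
    rw [← ZMod.intCast_zmod_eq_zero_iff_dvd, ← ofAdd_zsmul, ofAdd_eq_one, zsmul_one]
  obtain ⟨Ψ', hΨ'⟩ := D'.exists_hom_component t i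
  set X : Fin m → B × Multiplicative (ZMod n) := fun j => (x j, if j = i then t else 1)
  have hX : ∀ j, X j ^ n = 1 := by
    intro j
    refine Prod.ext (hx j) ?_
    change (if j = i then t else 1) ^ n = 1
    split_ifs
    · rw [← zpow_natCast, ht]
    · exact one_pow n
  obtain ⟨g', hg', hl'⟩ := D'.exists_isColouring_of_hom (Φ := Φ'.prod Ψ') (x := X) fun j =>
    Prod.ext (hΦ' j) (hΨ' j)
  obtain ⟨g, hg, hs⟩ := h _ X hX g' hg'
  obtain ⟨Θ, hΘ, hl⟩ := D.exists_hom_of_isColouring hg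
  obtain ⟨s, hs⟩ := hs i
  have key : Θ (D.longitude i) =
      X i ^ (D.framing i + s - D'.framing i) * (Φ' (D'.longitude i), Ψ' (D'.longitude i)) := by
    have := hl' i
    rw [MonoidHom.prod_apply] at this
    rw [this, hl, hs]
    group
  refine ⟨(MonoidHom.fst _ _).comp Θ, fun j => by simp [hΘ, X], ?_⟩
  have h2 : (Θ (D.longitude i)).2 = 1 :=
    D.map_longitude_eq_one t i (Ψ := (MonoidHom.snd _ _).comp Θ) fun j => by simp [hΘ, X]
  rw [key, Prod.snd_mul, D'.map_longitude_eq_one t i hΨ', mul_one, Prod.pow_snd] at h2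
  simp only [X, if_true] at h2
  obtain ⟨r, hr⟩ := (ht _).1 h2
  rw [MonoidHom.comp_apply, MonoidHom.coe_fst, key, hr, Prod.fst_mul, Prod.pow_fst, zpow_mul,
    zpow_natCast, hx, one_zpow, one_mul]

section LongitudeValue

variable {B : Type} [Group B] {k : ℕ}

/-- The image of the `i`th preferred longitude in a nilpotent group `B` under the homomorphism that sends
the meridians to `x`. This homomorphism is unique, because the meridians generate `G(D)` modulo any
term of the lower central series. -/
def longitudeValue (hB : (⊤ : Subgroup B).lowerCentralSeries k = ⊥) (x : Fin m → B) (i : Fin m)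
    (D : Diagram m) : B :=
  (D.exists_hom hB x).choose (D.longitude i)

variable (hB : (⊤ : Subgroup B).lowerCentralSeries k = ⊥) {x : Fin m → B} {i : Fin m}

theorem longitudeValue_eq_lift {D : Diagram m} {q : ℕ} (hq : k < q) {w : FreeGroup (Fin m)}
    (hw : D.IsLongitudeWord q i w) : longitudeValue hB x i D = FreeGroup.lift x w :=
  D.map_longitude_eq_lift hB hq (D.exists_hom hB x).choose_spec hw

theorem longitudeValue_eq_map {D : Diagram m} {Φ : D.WirtingerGroup →* B}
    (hΦ : ∀ j, Φ (D.meridian j) = x j) : longitudeValue hB x i D = Φ (D.longitude i) := by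
  obtain ⟨w, hw⟩ := D.exists_isLongitudeWord (k + 1) i
  rw [longitudeValue_eq_lift hB k.lt_succ_self hw,
    D.map_longitude_eq_lift hB k.lt_succ_self hΦ hw]

theorem ColouringsTransport.longitudeValue_eq {n : ℕ} {D D' : Diagram m}
    (h : ColouringsTransport n D D') (hx : ∀ j, x j ^ n = 1) :
    longitudeValue hB x i D = longitudeValue hB x i D' := by
  obtain ⟨Φ, hΦ, hl⟩ := h.exists_hom hx (D'.exists_hom hB x).choose_spec i
  rw [longitudeValue_eq_map hB hΦ, hl]
  rfl

theorem longitudeValue_eq_of_mk_eq {D D' : Diagram m}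
    (h : Quot.mk WeldedMove D = Quot.mk WeldedMove D') :
    longitudeValue hB x i D = longitudeValue hB x i D' :=
  congrArg (Quot.lift (longitudeValue hB x i) fun _ _ h =>
    h.colouringsTransport.longitudeValue_eq hB fun _ => pow_zero _) h

theorem longitudeValue_eq_of_vRelated {n : ℕ} (hx : ∀ j, x j ^ n = 1) {D D' : Diagram m}
    (h : VRelated n (Quot.mk WeldedMove D) (Quot.mk WeldedMove D')) :
    longitudeValue hB x i D = longitudeValue hB x i D' := by
  set f : WeldedStringLink m → B := Quot.lift (longitudeValue hB x i) fun _ _ h =>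
    h.colouringsTransport.longitudeValue_eq hB fun _ => pow_zero _
  have key : ∀ σ σ' : WeldedStringLink m, VRelated n σ σ' → f σ = f σ' := by
    intro σ σ' h
    induction h with
    | rel σ σ' h =>
      obtain ⟨D, D', rfl, rfl, h⟩ := h
      exact h.colouringsTransport.longitudeValue_eq hB hx
    | refl => rfl
    | symm _ _ _ ih => exact ih.symm
    | trans _ _ _ _ _ ih ih' => exact ih.trans ih'
  exact key _ _ h

end LongitudeValue

open NCSeries in
/-- Any longitude word of any diagram of a welded string link computes its welded Milnor invariants. -/
theorem isWeldedMilnor_iff (D : Diagram m) (J : List (Fin m)) (i : Fin m) {q : ℕ}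
    (hq : J.length < q) {w : FreeGroup (Fin m)} (hw : D.IsLongitudeWord q i w) (a : ℤ) :
    IsWeldedMilnor (Quot.mk _ D) J i a ↔ a = (magnus w : NCSeries m).coeff J := by
  constructor
  · rintro ⟨D', q', w', hD, hq', hw', rfl⟩
    have hB := lowerCentralSeries_unipotentQuotient m 0 J.length
    have h := longitudeValue_eq_of_mk_eq hB (x := quotientGen 0 (J.length + 1)) (i := i) hD
    rw [longitudeValue_eq_lift hB hq' hw', longitudeValue_eq_lift hB hq hw] at h
    simpa using coeff_magnus_modEq h (Nat.lt_succ_self _)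
  · rintro rfl
    exact ⟨D, q, w, rfl, hq, hw, rfl⟩

end WeldedSL

end

/-- Welded Milnor invariants of length at most `p` are invariant modulo the prime `p` under
`V^p`-moves. For a sequence `I = J ++ [i]`, the integers `μ` and `μ'` are the welded Milnor invariants
of `σ` and `σ'`, that is, the unique values. -/
theorem proposition3p4 (p : ℕ) (hp : p.Prime) (m : ℕ) (σ σ' : WeldedSL.WeldedStringLink m)
    (h : WeldedSL.VRelated p σ σ') (J : List (Fin m)) (i : Fin m) (hI : (J ++ [i]).length ≤ p) :
    ∃ μ μ' : ℤ, (∀ a : ℤ, WeldedSL.IsWeldedMilnor σ J i a ↔ a = μ) ∧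
      (∀ a : ℤ, WeldedSL.IsWeldedMilnor σ' J i a ↔ a = μ') ∧ μ ≡ μ' [ZMOD p] := by
  have hJ : J.length < p := by simpa using hI
  obtain ⟨D, rfl⟩ := Quot.exists_rep σ
  obtain ⟨D', rfl⟩ := Quot.exists_rep σ'
  obtain ⟨w, hw⟩ := D.exists_isLongitudeWord p i
  obtain ⟨w', hw'⟩ := D'.exists_isLongitudeWord p i
  refine ⟨_, _, WeldedSL.isWeldedMilnor_iff D J i hJ hw, WeldedSL.isWeldedMilnor_iff D' J i hJ hw', ?_⟩
  obtain ⟨k, rfl⟩ : ∃ k, p = k + 1 := ⟨p - 1, by omega⟩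
  have hB := WeldedSL.NCSeries.lowerCentralSeries_unipotentQuotient m (k + 1) k
  have hv := WeldedSL.longitudeValue_eq_of_vRelated hB (i := i)
    (WeldedSL.NCSeries.quotientGen_pow hp) h
  rw [WeldedSL.longitudeValue_eq_lift hB k.lt_succ_self hw,
    WeldedSL.longitudeValue_eq_lift hB k.lt_succ_self hw'] at hv
  exact WeldedSL.NCSeries.coeff_magnus_modEq hv hJ
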